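/- Let $k$ be an integer and let $S_k$ denote the space of cusp forms of weight $k$ for $\mathrm{SL}_2(\mathbf Z)$. For $f=\sum_{n\ge 1}a_nq^n\in S_k$ (with $q=e^{2\pi i z}$), let $L(f,s)$ be the Hecke $L$-function of $f$, that is, the unique entire function of $s$ equal to $\sum_{n\ge1}a_nn^{-s}$ for $\operatorname{Re}(s)>k/2+1$. A Hecke eigenform of weight $k$ is a nonzero $f\in S_k$ that is an eigenvector of all the Hecke operators $T_n$ ($n\ge1$), where $$(T_nf)(z)=n^{k-1}\sum_{\substack{ad=n,\ a,d\ge1\\ 0\le b<d}}d^{-k}f\!\left(\frac{az+b}{d}\right).$$ Then there exists a Hecke eigenform $f\in S_k$ with $L(f,k/2)\neq0$ if and only if $k\ge12$ and $4\mid k$. -/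

import Mathlib

open UpperHalfPlane hiding I
open scoped MatrixGroups

noncomputable section

namespace LevelOne

/-- The Hecke operator `T_n` of weight `k` for `SL₂(ℤ)`, for `n ≥ 1`:
`(T_n f)(z) = n^(k-1) ∑_{ad = n, 0 ≤ b < d} d^(-k) f((a z + b) / d)`.
(`ofComplex` only coerces the point `(a z + b) / d`, which has positive imaginary part, to `ℍ`.) -/
def heckeOperator (k : ℤ) (n : ℕ) (f : ℍ → ℂ) (z : ℍ) : ℂ :=
  (n : ℂ) ^ (k - 1) * ∑ d ∈ n.divisors, ∑ b ∈ Finset.range d,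
    (d : ℂ) ^ (-k) * f (ofComplex ((((n / d : ℕ) : ℂ) * (z : ℂ) + (b : ℂ)) / (d : ℂ)))

/-- A cuspidal Hecke eigenform for `SL₂(ℤ)`: a nonzero cusp form which is an eigenvector of all
the Hecke operators `T_n`, `n ≥ 1`. -/
def IsHeckeEigenform {k : ℤ} (f : CuspForm 𝒮ℒ k) : Prop :=
  f ≠ 0 ∧ ∀ n : ℕ, 1 ≤ n → ∃ c : ℂ, ∀ z : ℍ, heckeOperator k n f z = c * f z

/-- `L` is an entire function given, for `Re s > k/2 + 1`, by the Dirichlet series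
`∑_{n ≥ 1} a_n n^(-s)`, where `f = ∑_{n ≥ 1} a_n q^n`. -/
def IsHeckeLFunction {k : ℤ} (f : CuspForm 𝒮ℒ k) (L : ℂ → ℂ) : Prop :=
  Differentiable ℂ L ∧ ∀ s : ℂ, (k : ℝ) / 2 + 1 < s.re →
    LSeriesHasSum (fun n ↦ (qExpansion 1 f).coeff n) s (L s)

/-- Existence of the holomorphic continuation. -/
theorem exists_isHeckeLFunction {k : ℤ} (f : CuspForm 𝒮ℒ k) :
    ∃ L : ℂ → ℂ, IsHeckeLFunction f L := by
  by_cases hk : 0 < k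
  · refine ⟨ModularForm.L hk f, CuspForm.differentiable_L hk f, fun s hs ↦ ?_⟩
    have h := CuspForm.hasSum_L hk f hs
    have h0 : (qExpansion 1 f).coeff 0 = 0 :=
      CuspFormClass.qExpansion_coeff_zero f one_pos (by simp)
    simp only [Subgroup.strictWidthInfty_SL2Z, Complex.ofReal_one, Complex.one_cpow, one_mul] at h
    unfold LSeriesHasSum
    convert! h using 1
    ext n
    rcases eq_or_ne n 0 with rfl | hn
    · simp [h0]
    · simp [LSeries.term_of_ne_zero hn]
  · refine ⟨0, differentiable_const 0, fun s _ ↦ ?_⟩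
    have h := CuspForm.rank_eq_zero_of_weight_lt_twelve (k := k) (by omega)
    have hf : f = 0 := by
      have := rank_zero_iff.mp h
      exact Subsingleton.elim _ _
    subst hf
    have h0 : (fun n ↦ (qExpansion 1 (0 : CuspForm 𝒮ℒ k)).coeff n) = (0 : ℕ → ℂ) := by
      ext n
      simp [qExpansion_zero]
    have h1 : LSeries.term 0 s = 0 := by
      ext n
      simp [LSeries.term]
    rw [h0, LSeriesHasSum, h1]
    exact hasSum_zero

/-- Uniqueness of the holomorphic continuation. -/
theorem IsHeckeLFunction.unique {k : ℤ} {f : CuspForm 𝒮ℒ k} {L₁ L₂ : ℂ → ℂ}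
    (h₁ : IsHeckeLFunction f L₁) (h₂ : IsHeckeLFunction f L₂) : L₁ = L₂ := by
  have hopen : IsOpen {s : ℂ | (k : ℝ) / 2 + 1 < s.re} :=
    isOpen_lt continuous_const Complex.continuous_re
  refine AnalyticOnNhd.eq_of_eventuallyEq (z₀ := (((k : ℝ) / 2 + 2 : ℝ) : ℂ))
    (fun z _ ↦ h₁.1.analyticAt z) (fun z _ ↦ h₂.1.analyticAt z) ?_
  filter_upwards [hopen.mem_nhds (by simp)] with s hs
  exact (h₁.2 s hs).unique (h₂.2 s hs)

/-- The Hecke `L`-function `s ↦ L(f, s)` of a cusp form `f`, on all of `ℂ`. -/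
def heckeL {k : ℤ} (f : CuspForm 𝒮ℒ k) : ℂ → ℂ :=
  (exists_isHeckeLFunction f).choose

theorem heckeL_spec {k : ℤ} (f : CuspForm 𝒮ℒ k) : IsHeckeLFunction f (heckeL f) :=
  (exists_isHeckeLFunction f).choose_spec

end LevelOne

end

noncomputable section

namespace LevelOne

open MeasureTheory Matrix.SpecialLinearGroup
open scoped ENNReal

/-! ### A partition of unity for the action of `SL₂(ℤ)` on the upper half-plane -/

/-! Necessity: a weight below 12 carries no nonzero cusp form, and the completed function satisfies
Λ(k - s) = i^k Λ(s), so a nonzero value at the fixed point s = k/2 forces i^k = 1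
(`four_dvd_of_mellin_ne_zero`).

Sufficiency: for k = 12 + 4j the form Δ E₄^j is positive on the imaginary axis, so its Mellin
transform at k/2 integrates a positive function (`exists_cuspForm_mellin_ne_zero`). This form need
not be an eigenform, but the central value is linear in the form and the eigenforms span S_k, so
some eigenform has a nonzero central value.

Spanning (`iSup_iInf_eigenspace_heckeEnd`) holds because the T_p commute and are self-adjoint for
the Petersson product. Self-adjointness (`peterssonInner_hecke_symm`) avoids integrating over a
fundamental domain: a weight w ≥ 0 on ℍ with ∑_γ w(γz) = 1 turns the coset sum into T_n f(z) = ∑_M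
w(Mz) (f∣M)(z) over all integral M of determinant n. Then ⟨T_n f, g⟩ is a sum of integrals weighted
by w(z) w(Mz), symmetric under M ↔ adj M. Commutation, and the passage from the T_p to all T_n, come
from T_m T_p = T_{pm} + p^(k-1) T_{m/p} (last term only if p ∣ m), checked on Fourier coefficients.
-/

instance countable_SL2Z : Countable SL(2, ℤ) :=
  have : Countable (Matrix (Fin 2) (Fin 2) ℤ) := inferInstanceAs (Countable (Fin 2 → Fin 2 → ℤ))
  Subtype.countable

/-- An open vertical strip of finite volume which meets every orbit of `SL₂(ℤ)`. -/
def strip : Set ℍ := {z | |z.re| < 1 ∧ 1 / 2 < z.im}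

lemma isOpen_strip : IsOpen strip :=
  (isOpen_lt (continuous_abs.comp continuous_re) continuous_const).inter
    (isOpen_lt continuous_const continuous_im)

/-- The hyperbolic area is at most 2 ∫ dy / y² over y > 1/2. -/
lemma volume_strip_lt_top : volume strip < ⊤ := by
  rw [volume_eq_lintegral]
  have hsub : (UpperHalfPlane.coe '' strip) ⊆
      Complex.measurableEquivRealProd ⁻¹' (Set.Icc (-1) 1 ×ˢ Set.Ioi (1 / 2)) := by
    rintro _ ⟨z, ⟨h1, h2⟩, rfl⟩
    simp only [Complex.measurableEquivRealProd, Set.mem_preimage]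
    exact ⟨⟨(abs_lt.mp h1).1.le, (abs_lt.mp h1).2.le⟩, h2⟩
  refine (lintegral_mono_set hsub).trans_lt ?_
  have h := Complex.volume_preserving_equiv_real_prod.setLIntegral_comp_preimage_emb
    Complex.measurableEquivRealProd.measurableEmbedding
    (fun p : ℝ × ℝ ↦ (((1 / ‖p.2‖₊) ^ 2 : NNReal) : ℝ≥0∞)) (Set.Icc (-1) 1 ×ˢ Set.Ioi (1 / 2))
  have e : ∀ z : ℂ, (Complex.measurableEquivRealProd z).2 = z.im := fun z ↦ rfl
  simp only [e] at h
  rw [h, Measure.volume_eq_prod, ← Measure.prod_restrict, lintegral_prod _ (by fun_prop)]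
  simp only [lintegral_const]
  refine ENNReal.mul_lt_top ?_ (by simp)
  have hi := (integrableOn_Ioi_rpow_of_lt (a := -2) (by norm_num)
    (c := 1 / 2) (by norm_num)).lintegral_lt_top
  refine lt_of_eq_of_lt (setLIntegral_congr_fun measurableSet_Ioi fun y (hy : 1 / 2 < y) ↦ ?_) hi
  have hy0 : 0 < y := by linarith
  rw [← ENNReal.ofReal_coe_nnreal]
  congr 1
  simp [abs_of_pos hy0, Real.rpow_neg hy0.le]

/-- The strip contains the standard fundamental domain: |z| ≥ 1 and |Re z| ≤ 1/2 give (Im z)² ≥ 3/4.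
-/
lemma exists_smul_mem_strip (z : ℍ) : ∃ γ : SL(2, ℤ), γ • z ∈ strip := by
  obtain ⟨γ, hγ⟩ := ModularGroup.exists_smul_mem_fd z
  refine ⟨γ, lt_of_le_of_lt hγ.2 (by norm_num), ?_⟩
  have h1 := hγ.1
  have h2 := hγ.2
  rw [Complex.normSq_apply] at h1
  have h3 := (γ • z).im_pos
  rw [abs_le] at h2
  simp only [coe_re, coe_im] at h1
  nlinarith

/-- Heights in an orbit have a maximum, so an orbit point in the strip lies in a compact box; the
action is properly discontinuous. -/
lemma finite_smul_mem_strip (z : ℍ) : {γ : SL(2, ℤ) | γ • z ∈ strip}.Finite := by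
  obtain ⟨γ₀, hγ₀⟩ := ModularGroup.exists_max_im z
  set K : Set ℍ := {w | w.re ∈ Set.Icc (-1) 1 ∧ w.im ∈ Set.Icc (1 / 2) (γ₀ • z).im} with hK
  have hKc : IsCompact K := by
    rw [isOpenEmbedding_coe.isInducing.isCompact_iff]
    convert (isCompact_Icc (a := (-1 : ℝ)) (b := 1)).reProdIm
      (isCompact_Icc (a := (1 / 2 : ℝ)) (b := (γ₀ • z).im)) using 1
    ext w
    rw [Complex.mem_reProdIm]
    constructor
    · rintro ⟨w, hw, rfl⟩
      exact hw
    · rintro ⟨h1, h2⟩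
      exact ⟨⟨w, by linarith [h2.1]⟩, ⟨h1, h2⟩, rfl⟩
  have hfin := (inferInstance : ProperlyDiscontinuousSMul 𝒮ℒ ℍ).finite_disjoint_inter_image
    (isCompact_singleton (x := z)) hKc
  refine (hfin.preimage (f := fun γ : SL(2, ℤ) ↦ (⟨mapGL ℝ γ, γ, rfl⟩ : 𝒮ℒ)) ?_).subset ?_
  · intro γ _ δ _ h
    exact mapGL_injective (Subtype.ext_iff.mp h)
  · intro γ hγ
    refine ⟨γ • z, ⟨z, rfl, rfl⟩, ?_⟩
    exact ⟨⟨(abs_lt.mp hγ.1).1.le, (abs_lt.mp hγ.1).2.le⟩, hγ.2.le, hγ₀ γ⟩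

/-- The number of elements of `SL₂(ℤ)` that move a given point into the strip. -/
def stripCount (z : ℍ) : ℝ≥0∞ := ∑' γ : SL(2, ℤ), strip.indicator 1 (γ • z)

lemma stripCount_ne_top (z : ℍ) : stripCount z ≠ ⊤ := by
  have h : Function.support (fun γ : SL(2, ℤ) ↦ strip.indicator (1 : ℍ → ℝ≥0∞) (γ • z)) ⊆
      (finite_smul_mem_strip z).toFinset := by
    intro γ hγ
    simpa [-ModularGroup.sl_moeb] using hγ
  rw [stripCount, tsum_eq_sum' h]
  refine (ENNReal.sum_lt_top.mpr fun γ _ ↦ ?_).ne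
  exact (Set.indicator_le_self _ _ _).trans_lt (by simp)

lemma one_le_stripCount (z : ℍ) : 1 ≤ stripCount z := by
  obtain ⟨γ, hγ⟩ := exists_smul_mem_strip z
  refine le_trans ?_ (ENNReal.le_tsum γ)
  simp [Set.indicator_of_mem hγ, -ModularGroup.sl_moeb]

lemma stripCount_smul (γ : SL(2, ℤ)) (z : ℍ) : stripCount (γ • z) = stripCount z := by
  simp_rw [stripCount, ← mul_smul]
  exact (Equiv.mulRight γ).tsum_eq (fun δ : SL(2, ℤ) ↦ strip.indicator (1 : ℍ → ℝ≥0∞) (δ • z))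

lemma measurable_stripCount : Measurable stripCount := by
  refine Measurable.tsum fun γ ↦ ?_
  refine (measurable_one.indicator isOpen_strip.measurableSet).comp ?_
  exact measurable_const_smul (M := GL (Fin 2) ℝ) (mapGL ℝ γ)

/-- Nonnegative function with `∑ γ, weight (γ • z) = 1`. -/
def weight (z : ℍ) : ℝ := (strip.indicator 1 z / stripCount z).toReal

lemma weight_nonneg (z : ℍ) : 0 ≤ weight z := ENNReal.toReal_nonneg

lemma weight_le_one (z : ℍ) : weight z ≤ 1 := by
  refine ENNReal.toReal_le_of_le_ofReal zero_le_one ?_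
  rw [ENNReal.ofReal_one]
  refine ENNReal.div_le_of_le_mul ?_
  rw [one_mul]
  exact (Set.indicator_le_self _ _ _).trans (one_le_stripCount z)

lemma weight_of_notMem {z : ℍ} (hz : z ∉ strip) : weight z = 0 := by
  simp [weight, Set.indicator_of_notMem hz]

lemma weight_pos {z : ℍ} (hz : z ∈ strip) : 0 < weight z := by
  refine ENNReal.toReal_pos ?_ ?_
  · simp [Set.indicator_of_mem hz, stripCount_ne_top z]
  · rw [Set.indicator_of_mem hz]
    exact (ENNReal.div_lt_top (by simp) (one_pos.trans_le (one_le_stripCount z)).ne').ne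

lemma measurable_weight : Measurable weight :=
  ((measurable_one.indicator isOpen_strip.measurableSet).div measurable_stripCount).ennreal_toReal

lemma hasSum_weight (z : ℍ) : HasSum (fun γ : SL(2, ℤ) ↦ weight (γ • z)) 1 := by
  have h : ∑' γ : SL(2, ℤ), strip.indicator 1 (γ • z) / stripCount (γ • z) = 1 := by
    simp_rw [stripCount_smul, div_eq_mul_inv]
    rw [ENNReal.tsum_mul_right]
    exact ENNReal.mul_inv_cancel (one_pos.trans_le (one_le_stripCount z)).ne' (stripCount_ne_top z)
  have h' := ENNReal.hasSum_toReal (h.trans_ne ENNReal.one_ne_top)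
  rwa [← ENNReal.tsum_toReal_eq, h, ENNReal.toReal_one] at h'
  intro γ
  exact (ENNReal.div_lt_top ((Set.indicator_le_self _ _ _).trans_lt (by simp)).ne
    (one_pos.trans_le (one_le_stripCount _)).ne').ne

lemma integrable_weight : Integrable weight := by
  refine Integrable.mono' (g := strip.indicator 1) ?_ measurable_weight.aestronglyMeasurable ?_
  · exact (integrable_indicator_iff isOpen_strip.measurableSet).mpr
      (integrableOn_const volume_strip_lt_top.ne)
  · refine .of_forall fun z ↦ ?_
    by_cases hz : z ∈ strip
    · simpa [Set.indicator_of_mem hz, abs_of_nonneg (weight_nonneg z)] using weight_le_one z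
    · simp [weight_of_notMem hz, Set.indicator_of_notMem hz]

end LevelOne

end

noncomputable section

namespace LevelOne

open Matrix.SpecialLinearGroup
open scoped ModularForm

/-! ### Integral matrices of determinant `n` -/

section Matrices

variable {n : ℕ} [NeZero n]

instance countable_fixedDetMatrix (m : ℤ) : Countable (FixedDetMatrix (Fin 2) ℤ m) :=
  have : Countable (Matrix (Fin 2) (Fin 2) ℤ) := inferInstanceAs (Countable (Fin 2 → Fin 2 → ℤ))
  Subtype.countable

/-- An integral matrix of determinant `n`, as an element of `GL₂(ℝ)`. -/
def fixedDetGL (M : FixedDetMatrix (Fin 2) ℤ n) : GL (Fin 2) ℝ :=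
  Matrix.GeneralLinearGroup.mkOfDetNeZero (M.1.map (Int.castRingHom ℝ)) <| by
    rw [← RingHom.mapMatrix_apply, ← RingHom.map_det, M.2]
    simp [NeZero.ne]

@[simp]
lemma coe_fixedDetGL (M : FixedDetMatrix (Fin 2) ℤ n) :
    (fixedDetGL M : Matrix (Fin 2) (Fin 2) ℝ) = M.1.map (Int.castRingHom ℝ) := rfl

lemma det_fixedDetGL (M : FixedDetMatrix (Fin 2) ℤ n) : (fixedDetGL M).det.val = n := by
  rw [Matrix.GeneralLinearGroup.val_det_apply, coe_fixedDetGL, ← RingHom.mapMatrix_apply,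
    ← RingHom.map_det, M.2]
  simp

lemma fixedDetGL_smul (γ : SL(2, ℤ)) (M : FixedDetMatrix (Fin 2) ℤ n) :
    fixedDetGL (γ • M) = mapGL ℝ γ * fixedDetGL M := by
  apply Units.ext
  rw [coe_fixedDetGL, FixedDetMatrices.smul_coe, Matrix.map_mul]
  rfl

/-- Right multiplication by an element of `SL₂(ℤ)`. -/
def fixedDetMulRight (γ : SL(2, ℤ)) :
    FixedDetMatrix (Fin 2) ℤ n ≃ FixedDetMatrix (Fin 2) ℤ n where
  toFun M := ⟨M.1 * γ, by simp [M.2]⟩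
  invFun M := ⟨M.1 * (γ⁻¹ : SL(2, ℤ)), by rw [Matrix.det_mul, M.2, det_coe, mul_one]⟩
  left_inv M := FixedDetMatrices.ext' _ _ <| by
    simp only [mul_assoc, ← coe_mul, mul_inv_cancel, coe_one, mul_one]
  right_inv M := FixedDetMatrices.ext' _ _ <| by
    simp only [mul_assoc, ← coe_mul, inv_mul_cancel, coe_one, mul_one]

lemma fixedDetGL_mulRight (γ : SL(2, ℤ)) (M : FixedDetMatrix (Fin 2) ℤ n) :
    fixedDetGL (fixedDetMulRight γ M) = fixedDetGL M * mapGL ℝ γ := by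
  apply Units.ext
  rw [coe_fixedDetGL]
  exact Matrix.map_mul

/-- The adjugate, as an involution of the integral matrices of determinant `n`. -/
def fixedDetAdjugate : FixedDetMatrix (Fin 2) ℤ n ≃ FixedDetMatrix (Fin 2) ℤ n :=
  Function.Involutive.toPerm (fun M ↦ ⟨M.1.adjugate, by simp [Matrix.det_adjugate, M.2]⟩)
    fun M ↦ FixedDetMatrices.ext' _ _ <| by simp [Matrix.adjugate_adjugate]

lemma fixedDetGL_adjugate_mul (M : FixedDetMatrix (Fin 2) ℤ n) :
    fixedDetGL (fixedDetAdjugate M) * fixedDetGL M =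
      Matrix.GeneralLinearGroup.scalar (Fin 2) (Units.mk0 (n : ℝ) (NeZero.ne _)) := by
  apply Units.ext
  have h : (fixedDetAdjugate M).1 = M.1.adjugate := rfl
  simp only [Units.val_mul, coe_fixedDetGL, ← Matrix.map_mul, h, Matrix.adjugate_mul, M.2]
  ext i j
  fin_cases i <;> fin_cases j <;> simp [Matrix.natCast_apply]

lemma fixedDetGL_adjugate_smul (M : FixedDetMatrix (Fin 2) ℤ n) (z : ℍ) :
    fixedDetGL (fixedDetAdjugate M) • fixedDetGL M • z = z := by
  rw [← mul_smul, fixedDetGL_adjugate_mul]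
  ext
  rw [coe_smul_of_det_pos]
  · simp [num, denom, Matrix.natCast_apply, NeZero.ne]
  · have := NeZero.pos n
    simp
    positivity

/-- The product adj M · M is the scalar matrix n, which fixes every point and slashes by (n²)^(k-1)
n^(-k). -/
lemma slash_fixedDetGL_adjugate (k : ℤ) (f : ℍ → ℂ) (M : FixedDetMatrix (Fin 2) ℤ n) :
    (f ∣[k] fixedDetGL (fixedDetAdjugate M)) ∣[k] fixedDetGL M = ((n : ℂ) ^ (k - 2)) • f := by
  rw [← SlashAction.slash_mul, fixedDetGL_adjugate_mul]
  ext z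
  set g := Matrix.GeneralLinearGroup.scalar (Fin 2) (Units.mk0 (n : ℝ) (NeZero.ne _)) with hg
  have hn : (n : ℂ) ≠ 0 := NeZero.ne _
  have hdet : g.det.val = (n : ℝ) ^ 2 := by simp [hg]
  have hpos : 0 < g.det.val := by rw [hdet]; have := NeZero.pos n; positivity
  have hz : g • z = z := by
    ext
    rw [coe_smul_of_det_pos hpos]
    simp [hg, num, denom, Matrix.natCast_apply, NeZero.ne]
  have hden : denom g z = n := by simp [hg, denom, Matrix.natCast_apply]
  rw [ModularForm.slash_apply, hz, hden, hdet, σ, if_pos hpos]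
  simp only [ContinuousAlgEquiv.refl_apply, Pi.smul_apply, smul_eq_mul]
  have : ((|(n : ℝ) ^ 2| : ℝ) : ℂ) = (n : ℂ) ^ (2 : ℤ) := by
    rw [abs_of_nonneg (by positivity)]; push_cast; rfl
  rw [this, ← zpow_mul, mul_assoc, ← zpow_add₀ hn, mul_comm]
  ring_nf

end Matrices

/-! ### Coset representatives -/

/-- Indices `(d, b)` with `d ∣ n` and `0 ≤ b < d`. -/
def repIndex (n : ℕ) : Finset (Σ _ : ℕ, ℕ) := n.divisors.sigma fun d ↦ Finset.range d

/-- The representative `[n / d, b; 0, d]`. -/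
def cosetRep {n : ℕ} (p : repIndex n) : FixedDetMatrix (Fin 2) ℤ n :=
  ⟨!![((n / p.1.1 : ℕ) : ℤ), p.1.2; 0, p.1.1], by
    have h := p.2
    simp only [repIndex, Finset.mem_sigma, Nat.mem_divisors] at h
    rw [Matrix.det_fin_two_of, mul_zero, sub_zero]
    exact_mod_cast Nat.div_mul_cancel h.1.1⟩

lemma bijective_smul_cosetRep {n : ℕ} [NeZero n] :
    Function.Bijective fun p : repIndex n × SL(2, ℤ) ↦ p.2 • cosetRep p.1 := by
  have hmem (p : repIndex n) : (p.1.1 ∣ n ∧ n ≠ 0) ∧ p.1.2 < p.1.1 := by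
    simpa [repIndex] using p.2
  constructor
  · rintro ⟨p, γ⟩ ⟨q, δ⟩ (h : γ • cosetRep p = δ • cosetRep q)
    obtain ⟨ε, hε⟩ : ∃ ε : SL(2, ℤ), ε = γ⁻¹ * δ := ⟨_, rfl⟩
    have h1 : cosetRep p = ε • cosetRep q := by rw [hε, mul_smul, ← h, inv_smul_smul]
    have h2 : (cosetRep p).1 = ε.1 * (cosetRep q).1 := by rw [h1]; rfl
    have e01 := congr_fun₂ h2 0 1
    have e10 := congr_fun₂ h2 1 0
    have e11 := congr_fun₂ h2 1 1
    have hdet := ε.2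
    simp only [cosetRep, Matrix.mul_apply, Fin.sum_univ_two, Matrix.of_apply, Matrix.cons_val_zero,
      Matrix.cons_val_one, Matrix.cons_val', Matrix.cons_val_fin_one, mul_zero, add_zero]
      at e01 e10 e11
    rw [Matrix.det_fin_two] at hdet
    obtain ⟨⟨hp, hn⟩, hpb⟩ := hmem p
    obtain ⟨⟨hq, -⟩, hqb⟩ := hmem q
    have hq0 : ((n / q.1.1 : ℕ) : ℤ) ≠ 0 := by
      exact_mod_cast (Nat.div_pos (Nat.le_of_dvd (Nat.pos_of_ne_zero hn) hq) (by omega)).ne'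
    -- An ε in SL₂(ℤ) carrying one representative to another is upper triangular; positivity of d
    -- then makes its diagonal 1.
    have c0 : ε.1 1 0 = 0 := (mul_eq_zero.mp e10.symm).resolve_right hq0
    rw [c0, mul_zero, sub_zero] at hdet
    rw [c0, zero_mul, zero_add] at e11
    have d1 : ε.1 1 1 = 1 := by
      rcases Int.isUnit_iff.mp (isUnit_of_mul_isUnit_right (hdet ▸ isUnit_one)) with h | h
      · exact h
      · rw [h] at e11; omega
    rw [d1, mul_one] at hdet
    rw [d1, one_mul] at e11
    have hdd : p.1.1 = q.1.1 := by exact_mod_cast e11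
    rw [hdet, one_mul] at e01
    -- The two offsets lie in [0, d) and differ by a multiple of d.
    have b0 : ε.1 0 1 = 0 := by
      by_contra hb
      have hd0 : (0 : ℤ) < q.1.1 := by omega
      rcases lt_or_gt_of_ne hb with hb | hb <;> nlinarith
    have hb : p.1.2 = q.1.2 := by rw [b0, zero_mul, add_zero] at e01; exact_mod_cast e01
    have hε1 : ε = 1 := by
      ext i j
      fin_cases i <;> fin_cases j <;> simp [c0, d1, b0, hdet]
    rw [hε, inv_mul_eq_one] at hε1
    rw [Prod.mk.injEq]
    exact ⟨Subtype.ext (Sigma.ext hdd (heq_of_eq hb)), hε1⟩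
  · intro A
    have hn : (n : ℤ) ≠ 0 := NeZero.ne _
    -- Every matrix is reached from a reduced upper triangular one by left multiplication by S and
    -- T, and the reduced ones with 0 ≤ b < d are the representatives.
    induction A using FixedDetMatrices.induction_on hn with
    | h0 A h10 h00 h01 h11 =>
      have hdet := A.2
      rw [Matrix.det_fin_two, h10, mul_zero, sub_zero] at hdet
      have hd : 0 < A.1 1 1 := by
        have : (0 : ℤ) < n := by exact_mod_cast NeZero.pos n
        rw [← hdet] at this
        exact pos_of_mul_pos_right this h00.le
      rw [abs_of_nonneg h01, abs_of_pos hd] at h11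
      obtain ⟨a, ha⟩ := Int.eq_ofNat_of_zero_le h00.le
      obtain ⟨b, hb⟩ := Int.eq_ofNat_of_zero_le h01
      obtain ⟨d, hd'⟩ := Int.eq_ofNat_of_zero_le hd.le
      rw [ha, hd'] at hdet
      have hadn : a * d = n := by exact_mod_cast hdet
      have hd0 : 0 < d := by omega
      refine ⟨(⟨⟨d, b⟩, ?_⟩, 1), ?_⟩
      · simp only [repIndex, Finset.mem_sigma, Nat.mem_divisors, Finset.mem_range]
        exact ⟨⟨Dvd.intro_left a hadn, NeZero.ne n⟩, by omega⟩
      · have : n / d = a := by rw [← hadn, Nat.mul_div_cancel _ hd0]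
        simp only [one_smul]
        ext i j
        fin_cases i <;> fin_cases j <;> simp [cosetRep, ha, hb, hd', h10, this]
    | hS B hB =>
      obtain ⟨p, rfl⟩ := hB
      exact ⟨(p.1, ModularGroup.S * p.2), mul_smul _ _ _⟩
    | hT B hB =>
      obtain ⟨p, rfl⟩ := hB
      exact ⟨(p.1, ModularGroup.T * p.2), mul_smul _ _ _⟩

lemma coe_fixedDetGL_cosetRep {n : ℕ} [NeZero n] (p : repIndex n) :
    (fixedDetGL (cosetRep p) : Matrix (Fin 2) (Fin 2) ℝ) =
      !![((n / p.1.1 : ℕ) : ℝ), p.1.2; 0, p.1.1] := by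
  rw [coe_fixedDetGL]
  ext i j
  fin_cases i <;> fin_cases j <;> simp [cosetRep, -Int.natCast_ediv]

lemma coe_cosetRep_smul {n : ℕ} [NeZero n] (p : repIndex n) (z : ℍ) :
    ((fixedDetGL (cosetRep p) • z : ℍ) : ℂ) =
      (((n / p.1.1 : ℕ) : ℂ) * (z : ℂ) + (p.1.2 : ℂ)) / (p.1.1 : ℂ) := by
  rw [coe_smul_of_det_pos]
  · simp only [num, denom, coe_fixedDetGL_cosetRep]
    simp
  · rw [det_fixedDetGL]; exact_mod_cast NeZero.pos n

/-- The factor n^(k-1) d^(-k) is exactly the det^(k-1) denom^(-k) of the slash action. -/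
lemma heckeOperator_eq_sum_slash (k : ℤ) {n : ℕ} [NeZero n] (f : ℍ → ℂ) (z : ℍ) :
    heckeOperator k n f z = ∑ p : repIndex n, (f ∣[k] fixedDetGL (cosetRep p)) z := by
  rw [heckeOperator, Finset.sum_sigma', Finset.mul_sum, ← repIndex, ← Finset.sum_coe_sort]
  refine Finset.sum_congr rfl fun p _ ↦ ?_
  have hpos : 0 < (fixedDetGL (cosetRep p)).det.val := by
    rw [det_fixedDetGL]; exact_mod_cast NeZero.pos n
  have hden : denom (fixedDetGL (cosetRep p)) z = p.1.1 := by
    simp only [denom, coe_fixedDetGL_cosetRep]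
    simp
  rw [ModularForm.slash_apply, ← coe_cosetRep_smul, ofComplex_apply, hden, det_fixedDetGL, σ,
    if_pos hpos]
  simp
  ring

end LevelOne

end

noncomputable section

namespace LevelOne

open MeasureTheory Matrix.SpecialLinearGroup
open scoped ModularForm Manifold ComplexConjugate

/-! ### Unfolding coset sums with the partition of unity -/

section Unfolding

variable {n : ℕ} [NeZero n]

/-- A sum over coset representatives, rewritten as a weighted sum over all integral matrices of
determinant `n`. -/
lemma hasSum_weight_smul {E : Type*} [NormedAddCommGroup E] [NormedSpace ℝ E] [CompleteSpace E]
    {φ : FixedDetMatrix (Fin 2) ℤ n → E}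
    (hφ : ∀ (γ : SL(2, ℤ)) M, φ (γ • M) = φ M) (z : ℍ) :
    HasSum (fun M ↦ weight (fixedDetGL M • z) • φ M) (∑ p : repIndex n, φ (cosetRep p)) := by
  -- Writing M = γ • (representative), φ depends only on the representative and the weights sum to 1
  -- over γ.
  rw [← (Equiv.ofBijective _ (bijective_smul_cosetRep (n := n))).hasSum_iff]
  have key (p : repIndex n) (γ : SL(2, ℤ)) :
      weight (fixedDetGL (γ • cosetRep p) • z) • φ (γ • cosetRep p) =
        weight (γ • fixedDetGL (cosetRep p) • z) • φ (cosetRep p) := by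
    rw [hφ, fixedDetGL_smul, mul_smul]; rfl
  have hsum (p : repIndex n) :
      HasSum (fun γ : SL(2, ℤ) ↦ weight (γ • fixedDetGL (cosetRep p) • z) • φ (cosetRep p))
        (φ (cosetRep p)) := by
    simpa only [one_smul] using (hasSum_weight (fixedDetGL (cosetRep p) • z)).smul_const _
  have hs : Summable fun q : repIndex n × SL(2, ℤ) ↦
      weight (q.2 • fixedDetGL (cosetRep q.1) • z) • φ (cosetRep q.1) := by
    refine Summable.of_norm ((summable_prod_of_nonneg fun _ ↦ norm_nonneg _).mpr
      ⟨fun p ↦ ?_, (hasSum_fintype _).summable⟩)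
    simp_rw [norm_smul, Real.norm_of_nonneg (weight_nonneg _)]
    exact (hasSum_weight _).summable.mul_right _
  have := (hs.hasSum.prod_fiberwise hsum).unique (hasSum_fintype _)
  rw [← this]
  exact hs.hasSum.congr_fun fun q ↦ key q.1 q.2

end Unfolding

/-! ### Hecke operators as endomorphisms of the space of cusp forms -/

section Operators

variable {k : ℤ}

lemma heckeOperator_eq_finset_sum (n : ℕ) [NeZero n] (f : ℍ → ℂ) :
    heckeOperator k n f = ∑ p : repIndex n, (f ∣[k] fixedDetGL (cosetRep p)) := by
  ext z
  rw [heckeOperator_eq_sum_slash, Finset.sum_apply]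

lemma slash_fixedDetGL_smul {n : ℕ} [NeZero n] (f : CuspForm 𝒮ℒ k) (γ : SL(2, ℤ))
    (M : FixedDetMatrix (Fin 2) ℤ n) :
    (⇑f ∣[k] fixedDetGL (γ • M)) = ⇑f ∣[k] fixedDetGL M := by
  rw [fixedDetGL_smul, SlashAction.slash_mul,
    SlashInvariantFormClass.slash_action_eq f (mapGL ℝ γ) (MonoidHom.mem_range.mpr ⟨γ, rfl⟩)]

lemma hasSum_heckeOperator {n : ℕ} [NeZero n] (f : CuspForm 𝒮ℒ k) (z : ℍ) :
    HasSum (fun M : FixedDetMatrix (Fin 2) ℤ n ↦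
      weight (fixedDetGL M • z) • (⇑f ∣[k] fixedDetGL M) z) (heckeOperator k n f z) := by
  rw [heckeOperator_eq_sum_slash]
  exact hasSum_weight_smul (φ := fun M ↦ (⇑f ∣[k] fixedDetGL M) z)
    (fun γ M ↦ by rw [slash_fixedDetGL_smul]) z

/-- In the weighted sum over all matrices, slashing by γ only replaces M by Mγ, which permutes the
index set. -/
lemma heckeOperator_slash (n : ℕ) [NeZero n] (f : CuspForm 𝒮ℒ k) (γ : SL(2, ℤ)) :
    heckeOperator k n f ∣[k] γ = heckeOperator k n f := by
  have h := heckeOperator_eq_finset_sum (k := k) n f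
  ext z
  rw [h, ModularForm.SL_slash, SlashAction.sum_slash, ← h, Finset.sum_apply]
  have h1 := hasSum_weight_smul (n := n)
    (φ := fun M ↦ ((⇑f ∣[k] fixedDetGL M) ∣[k] (γ : GL (Fin 2) ℝ)) z)
    (fun δ M ↦ by rw [slash_fixedDetGL_smul]) (γ • z)
  refine h1.unique ?_
  have h2 := (fixedDetMulRight γ).hasSum_iff.mpr (hasSum_heckeOperator (n := n) f z)
  refine h2.congr_fun fun M ↦ ?_
  simp only [Function.comp_apply, fixedDetGL_mulRight, SlashAction.slash_mul, mul_smul]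
  rfl

/-- The representatives are upper triangular, hence fix ∞, so each summand inherits vanishing from
the cusp condition on `f`. -/
lemma isZeroAtImInfty_heckeOperator (n : ℕ) [NeZero n] (f : CuspForm 𝒮ℒ k) :
    IsZeroAtImInfty (heckeOperator k n f) := by
  have h (p : repIndex n) : IsZeroAtImInfty (⇑f ∣[k] fixedDetGL (cosetRep p)) := by
    refine CuspFormClass.zero_at_cusps f (c := OnePoint.infty) Fact.out _ ?_
    rw [OnePoint.smul_infty_eq_self_iff, coe_fixedDetGL_cosetRep]
    simp
  have : heckeOperator k n f = ∑ p : repIndex n, (⇑f ∣[k] fixedDetGL (cosetRep p)) := by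
    ext z
    rw [heckeOperator_eq_sum_slash, Finset.sum_apply]
  rw [this]
  unfold IsZeroAtImInfty Filter.ZeroAtFilter
  simpa [Finset.sum_fn] using tendsto_finsetSum Finset.univ fun p _ ↦ h p

/-- The Hecke operator `T_n` on cusp forms. -/
def heckeCuspForm (n : ℕ) [NeZero n] (f : CuspForm 𝒮ℒ k) : CuspForm 𝒮ℒ k where
  toFun := heckeOperator k n f
  slash_action_eq' := by
    rintro _ ⟨γ, rfl⟩
    exact heckeOperator_slash n f γ
  holo' := by
    have : heckeOperator k n f = ∑ p : repIndex n, (⇑f ∣[k] fixedDetGL (cosetRep p)) := by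
      ext z
      rw [heckeOperator_eq_sum_slash, Finset.sum_apply]
    change MDiff (heckeOperator k n f)
    rw [this]
    exact MDifferentiable.sum fun p _ ↦ f.holo'.slash k _
  zero_at_cusps' hc := by
    rw [OnePoint.isZeroAt_iff_forall_SL2Z hc]
    intro γ _
    change IsZeroAtImInfty (heckeOperator k n f ∣[k] γ)
    rw [heckeOperator_slash]
    exact isZeroAtImInfty_heckeOperator n f

@[simp]
lemma coe_heckeCuspForm (n : ℕ) [NeZero n] (f : CuspForm 𝒮ℒ k) :
    ⇑(heckeCuspForm n f) = heckeOperator k n f := rfl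

lemma heckeOperator_add (n : ℕ) (f g : ℍ → ℂ) :
    heckeOperator k n (f + g) = heckeOperator k n f + heckeOperator k n g := by
  ext z
  simp only [heckeOperator, Pi.add_apply, mul_add, Finset.sum_add_distrib]

lemma heckeOperator_smul (n : ℕ) (c : ℂ) (f : ℍ → ℂ) :
    heckeOperator k n (c • f) = c • heckeOperator k n f := by
  ext z
  simp only [heckeOperator, Pi.smul_apply, smul_eq_mul, Finset.mul_sum]
  refine Finset.sum_congr rfl fun d _ ↦ Finset.sum_congr rfl fun b _ ↦ ?_
  ring

/-- The Hecke operator `T_n` as a linear endomorphism of the space of cusp forms. -/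
def heckeEnd (k : ℤ) (n : ℕ) [NeZero n] : Module.End ℂ (CuspForm 𝒮ℒ k) where
  toFun := heckeCuspForm n
  map_add' f g := by
    apply DFunLike.coe_injective
    simp [heckeOperator_add]
  map_smul' c f := by
    apply DFunLike.coe_injective
    simp [heckeOperator_smul]

end Operators

end LevelOne

end

noncomputable section

namespace LevelOne

open MeasureTheory Matrix.SpecialLinearGroup
open scoped ModularForm Manifold ComplexConjugate

/-! ### The Petersson scalar product -/

section Petersson

variable {k : ℤ}

/-- The Petersson scalar product of two cusp forms of weight `k` for `SL₂(ℤ)`. -/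
def peterssonInner (f g : CuspForm 𝒮ℒ k) : ℂ := ∫ z : ℍ, weight z • petersson k f g z

lemma integrable_weight_smul_petersson (f g : CuspForm 𝒮ℒ k) :
    Integrable fun z : ℍ ↦ weight z • petersson k f g z := by
  obtain ⟨C, hC⟩ := CuspFormClass.petersson_bounded_left k 𝒮ℒ f g
  refine integrable_weight.smul_bdd C ?_ (.of_forall hC)
  exact (petersson_continuous k (ModularFormClass.continuous f)
    (ModularFormClass.continuous g)).aestronglyMeasurable

lemma conj_peterssonInner (f g : CuspForm 𝒮ℒ k) :
    conj (peterssonInner g f) = peterssonInner f g := by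
  rw [peterssonInner, ← integral_conj]
  refine integral_congr_ae (.of_forall fun z ↦ ?_)
  simp only [petersson_symm k f g, Complex.real_smul, map_mul, Complex.conj_conj,
    Complex.conj_ofReal]

lemma peterssonInner_add_left (f g h : CuspForm 𝒮ℒ k) :
    peterssonInner (f + g) h = peterssonInner f h + peterssonInner g h := by
  rw [peterssonInner, peterssonInner, peterssonInner, ← integral_add
    (integrable_weight_smul_petersson f h) (integrable_weight_smul_petersson g h)]
  refine integral_congr_ae (.of_forall fun z ↦ ?_)
  simp [petersson]
  ring

lemma peterssonInner_smul_left (f g : CuspForm 𝒮ℒ k) (c : ℂ) :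
    peterssonInner (c • f) g = conj c * peterssonInner f g := by
  rw [peterssonInner, peterssonInner, ← integral_const_mul]
  refine integral_congr_ae (.of_forall fun z ↦ ?_)
  simp [petersson]
  ring

lemma petersson_self (f : ℍ → ℂ) (z : ℍ) :
    petersson k f f z = ((‖f z‖ ^ 2 * z.im ^ k : ℝ) : ℂ) := by
  rw [petersson, Complex.conj_mul']
  push_cast
  rfl

lemma peterssonInner_self (f : CuspForm 𝒮ℒ k) :
    peterssonInner f f = ((∫ z : ℍ, weight z * (‖f z‖ ^ 2 * z.im ^ k) : ℝ) : ℂ) := by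
  rw [peterssonInner, ← integral_complex_ofReal]
  refine integral_congr_ae (.of_forall fun z ↦ ?_)
  simp only [petersson_self, Complex.real_smul]
  push_cast
  rfl

instance isOpenPosMeasure_volume : (volume : Measure ℍ).IsOpenPosMeasure where
  open_pos U hU hne h0 := by
    rw [volume_eq_lintegral] at h0
    refine (lt_irrefl (0 : ENNReal)) (h0 ▸ (setLIntegral_pos_iff ?_).mpr ?_)
    · fun_prop
    · refine (isOpenEmbedding_coe.isOpenMap U hU).measure_pos volume (hne.image _) |>.trans_le ?_
      refine measure_mono ?_
      rintro _ ⟨z, hz, rfl⟩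
      refine ⟨?_, z, hz, rfl⟩
      simp [z.im_ne_zero]

/-- A zero integral makes `f` vanish almost everywhere on the strip, by continuity everywhere on it,
and by modularity on all of ℍ. -/
lemma eq_zero_of_peterssonInner_self (f : CuspForm 𝒮ℒ k) (h : peterssonInner f f = 0) :
    f = 0 := by
  rw [peterssonInner_self, Complex.ofReal_eq_zero, integral_eq_zero_iff_of_nonneg] at h
  · have hcont : Continuous f := ModularFormClass.continuous f
    have h1 : f =ᵐ[volume.restrict strip] 0 := by
      rw [Filter.EventuallyEq, ae_restrict_iff' isOpen_strip.measurableSet]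
      filter_upwards [h] with z hz hzs
      have := z.im_pos
      simpa [(weight_pos hzs).ne', (zpow_pos this k).ne'] using hz
    have h2 := Measure.eqOn_open_of_ae_eq h1 isOpen_strip hcont.continuousOn continuousOn_const
    ext z
    obtain ⟨γ, hγ⟩ := exists_smul_mem_strip z
    have h3 := SlashInvariantFormClass.slash_action_eq f (mapGL ℝ γ)
      (MonoidHom.mem_range.mpr ⟨γ, rfl⟩)
    rw [← h3]
    have h4 : f (mapGL ℝ γ • z) = 0 := h2 hγ
    simp [ModularForm.slash_apply, h4]
  · intro z
    have := weight_nonneg z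
    have := z.im_pos
    positivity
  · have := (integrable_weight_smul_petersson f f).re
    refine this.congr (.of_forall fun z ↦ ?_)
    simp only [petersson_self, Complex.real_smul]
    rw [← Complex.ofReal_mul]
    simp [-Complex.ofReal_mul]

lemma re_peterssonInner_self_nonneg (f : CuspForm 𝒮ℒ k) : 0 ≤ (peterssonInner f f).re := by
  rw [peterssonInner_self, Complex.ofReal_re]
  refine integral_nonneg fun z ↦ ?_
  have := weight_nonneg z
  have := z.im_pos
  positivity

/-- The Petersson scalar product turns the cusp forms of weight `k` into an inner product space. -/
@[reducible]
def peterssonCore (k : ℤ) : InnerProductSpace.Core ℂ (CuspForm 𝒮ℒ k) where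
  inner := peterssonInner
  conj_inner_symm := conj_peterssonInner
  re_inner_nonneg := re_peterssonInner_self_nonneg
  add_left := peterssonInner_add_left
  smul_left := peterssonInner_smul_left
  definite := eq_zero_of_peterssonInner_self

end Petersson

/-! ### Self-adjointness of the Hecke operators -/

section SelfAdjoint

variable {k : ℤ} {n : ℕ} [NeZero n]

/-- Pointwise adjointness of M and adj M: the factor n^(k-2) from `petersson_slash` cancels the one
from `slash_fixedDetGL_adjugate`. -/
lemma petersson_slash_fixedDetGL (f g : ℍ → ℂ) (M : FixedDetMatrix (Fin 2) ℤ n) (z : ℍ) :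
    petersson k (f ∣[k] fixedDetGL M) g z =
      petersson k f (g ∣[k] fixedDetGL (fixedDetAdjugate M)) (fixedDetGL M • z) := by
  have hn : (n : ℂ) ^ (k - 2) ≠ 0 := zpow_ne_zero _ (NeZero.ne _)
  have h := petersson_slash k f (g ∣[k] fixedDetGL (fixedDetAdjugate M)) (fixedDetGL M) z
  have hpos : 0 < (fixedDetGL M).det.val := by
    rw [det_fixedDetGL]; exact_mod_cast NeZero.pos n
  rw [slash_fixedDetGL_adjugate, σ, if_pos hpos, det_fixedDetGL] at h
  apply mul_left_cancel₀ hn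
  simp only [Nat.abs_cast, Complex.ofReal_natCast, ContinuousAlgEquiv.refl_apply] at h
  rw [← h]
  simp only [petersson, Pi.smul_apply, smul_eq_mul]
  ring

/-- The slashed form is no longer of level one, so the mixed term is bounded through |F||g| ≤ |F|² +
|g|², whose diagonal terms are Petersson functions of `f` and `g`. -/
lemma exists_bound_petersson_slash (f g : CuspForm 𝒮ℒ k) (M : FixedDetMatrix (Fin 2) ℤ n) :
    ∃ C, ∀ z, ‖petersson k (⇑f ∣[k] fixedDetGL M) g z‖ ≤ C := by
  obtain ⟨A, hA⟩ := CuspFormClass.petersson_bounded_left k 𝒮ℒ f f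
  obtain ⟨B, hB⟩ := CuspFormClass.petersson_bounded_left k 𝒮ℒ g g
  refine ⟨(n : ℝ) ^ (k - 2) * A + B, fun z ↦ ?_⟩
  have h1 : ‖petersson k (⇑f ∣[k] fixedDetGL M) (⇑f ∣[k] fixedDetGL M) z‖ ≤ (n : ℝ) ^ (k - 2) * A := by
    rw [petersson_slash, det_fixedDetGL, norm_mul, norm_σ]
    simp only [Nat.abs_cast, Complex.ofReal_natCast, norm_zpow, Complex.norm_natCast]
    exact mul_le_mul_of_nonneg_left (hA _) (by positivity)
  have h2 := hB z
  generalize ⇑f ∣[k] fixedDetGL M = F at *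
  simp only [petersson, norm_mul, Complex.norm_conj] at *
  have : 0 ≤ ‖((z.im : ℂ) ^ k)‖ := norm_nonneg _
  nlinarith [mul_nonneg this (sq_nonneg (‖F z‖ - ‖g z‖)), mul_nonneg this (sq_nonneg (‖F z‖ + ‖g z‖))]

lemma continuous_slash_fixedDetGL (f : CuspForm 𝒮ℒ k) (M : FixedDetMatrix (Fin 2) ℤ n) :
    Continuous (⇑f ∣[k] fixedDetGL M) :=
  (f.holo'.slash k _).continuous

lemma hasSum_weight_petersson (f g : CuspForm 𝒮ℒ k) (z : ℍ) :
    HasSum (fun M : FixedDetMatrix (Fin 2) ℤ n ↦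
      weight (fixedDetGL M • z) • petersson k (⇑f ∣[k] fixedDetGL M) g z)
      (petersson k (heckeCuspForm n f) g z) := by
  have h := hasSum_weight_smul (n := n) (φ := fun M ↦ petersson k (⇑f ∣[k] fixedDetGL M) g z)
    (fun γ M ↦ by rw [slash_fixedDetGL_smul]) z
  have e : petersson k (heckeCuspForm n f) g z =
      ∑ p : repIndex n, petersson k (⇑f ∣[k] fixedDetGL (cosetRep p)) g z := by
    simp only [petersson, coe_heckeCuspForm, heckeOperator_eq_sum_slash, map_sum,
      Finset.sum_mul]
  rw [e]
  exact h

lemma peterssonInner_hecke_left (f g : CuspForm 𝒮ℒ k) :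
    peterssonInner (heckeCuspForm n f) g = ∑' M : FixedDetMatrix (Fin 2) ℤ n,
      ∫ z : ℍ, weight z • weight (fixedDetGL M • z) •
        petersson k (⇑f ∣[k] fixedDetGL M) g z := by
  have hmeas (M : FixedDetMatrix (Fin 2) ℤ n) : Measurable fun z : ℍ ↦
      weight z • weight (fixedDetGL M • z) • petersson k (⇑f ∣[k] fixedDetGL M) g z :=
    measurable_weight.smul ((measurable_weight.comp (measurable_const_smul _)).smul
      (petersson_continuous k (continuous_slash_fixedDetGL f M)
        (ModularFormClass.continuous g)).measurable)
  rw [← integral_tsum (fun M ↦ (hmeas M).aestronglyMeasurable), peterssonInner]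
  · refine integral_congr_ae (.of_forall fun z ↦ ?_)
    exact ((hasSum_weight_petersson f g z).const_smul (weight z)).tsum_eq.symm
  · rw [← lintegral_tsum fun M ↦ (hmeas M).enorm.aemeasurable]
    choose C hC using exists_bound_petersson_slash (n := n) f g
    refine ne_top_of_le_ne_top (b := ∫⁻ z : ℍ,
      ENNReal.ofReal (weight z * ∑ p : repIndex n, C (cosetRep p))) ?_ ?_
    · exact (integrable_weight.mul_const _).lintegral_lt_top.ne
    refine lintegral_mono fun z ↦ ?_
    -- The unfolding identity applied to norms turns the infinite sum into a finite, bounded one,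
    -- which justifies exchanging sum and integral.
    have h1 := hasSum_weight_smul (n := n)
      (φ := fun M ↦ ‖petersson k (⇑f ∣[k] fixedDetGL M) g z‖)
      (fun γ M ↦ by rw [slash_fixedDetGL_smul]) z
    have h2 := h1.const_smul (weight z)
    have h3 (M : FixedDetMatrix (Fin 2) ℤ n) :
        ‖weight z • weight (fixedDetGL M • z) • petersson k (⇑f ∣[k] fixedDetGL M) g z‖ₑ =
        ENNReal.ofReal (weight z • weight (fixedDetGL M • z) •
          ‖petersson k (⇑f ∣[k] fixedDetGL M) g z‖) := by
      rw [← ofReal_norm, norm_smul, norm_smul, Real.norm_of_nonneg (weight_nonneg _),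
        Real.norm_of_nonneg (weight_nonneg _)]
      rfl
    simp_rw [h3]
    rw [← ENNReal.ofReal_tsum_of_nonneg _ h2.summable, h2.tsum_eq]
    · refine ENNReal.ofReal_le_ofReal (mul_le_mul_of_nonneg_left ?_ (weight_nonneg z))
      exact Finset.sum_le_sum fun p _ ↦ hC _ z
    · intro M
      exact mul_nonneg (weight_nonneg _) (mul_nonneg (weight_nonneg _) (norm_nonneg _))

/-- Replace M by adj M, then substitute z ↦ Mz, which preserves the measure: the weights w(z) and
w(Mz) trade places and the slash moves from `f` to `g`. -/
theorem peterssonInner_hecke_symm (f g : CuspForm 𝒮ℒ k) :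
    peterssonInner (heckeCuspForm n f) g = peterssonInner f (heckeCuspForm n g) := by
  rw [← conj_peterssonInner f, peterssonInner_hecke_left, peterssonInner_hecke_left,
    Complex.conj_tsum, ← (fixedDetAdjugate (n := n)).tsum_eq]
  refine tsum_congr fun M ↦ ?_
  rw [← integral_conj, ← integral_smul_eq_self (g := fixedDetGL M)]
  refine integral_congr_ae (.of_forall fun z ↦ ?_)
  have hM : fixedDetAdjugate (fixedDetAdjugate M) = M := fixedDetAdjugate.left_inv M
  simp only [fixedDetGL_adjugate_smul, petersson_slash_fixedDetGL (⇑f), hM,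
    petersson_symm k f, Complex.real_smul, map_mul, Complex.conj_ofReal, Complex.conj_conj]
  ring

end SelfAdjoint

end LevelOne

end

noncomputable section

namespace LevelOne

/-! ### Hecke operators on Fourier coefficients -/

local notation "𝕢" => Function.Periodic.qParam

/-- The action of the Hecke operator `T_n` of weight `k` on sequences of Fourier coefficients. -/
def heckeCoeff (k : ℤ) (n : ℕ) (a : ℕ → ℂ) (l : ℕ) : ℂ :=
  ∑ d ∈ n.divisors, if d ∣ l then (d : ℂ) ^ (k - 1) * a (n / d * (l / d)) else 0

/-- Orthogonality: the sum over b is a geometric sum of m-th powers of d-th roots of unity. -/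
lemma sum_qParam_pow {d : ℕ} (hd : d ≠ 0) (e m : ℕ) (z : ℂ) :
    ∑ b ∈ Finset.range d, 𝕢 1 (((e : ℂ) * z + b) / d) ^ m =
      if d ∣ m then (d : ℂ) * 𝕢 1 z ^ (e * (m / d)) else 0 := by
  have hd' : (d : ℂ) ≠ 0 := by exact_mod_cast hd
  set ζ := Complex.exp (2 * Real.pi * Complex.I / d) with hζ
  have hprim : IsPrimitiveRoot ζ d := Complex.isPrimitiveRoot_exp d hd
  have hterm (b : ℕ) : 𝕢 1 (((e : ℂ) * z + b) / d) ^ m =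
      Complex.exp (2 * Real.pi * Complex.I * e * z * m / d) * (ζ ^ m) ^ b := by
    rw [hζ, Function.Periodic.qParam, ← Complex.exp_nat_mul, ← Complex.exp_nat_mul,
      ← Complex.exp_nat_mul, ← Complex.exp_add]
    congr 1
    push_cast
    field_simp
  simp_rw [hterm, ← Finset.mul_sum]
  split_ifs with h
  · obtain ⟨t, rfl⟩ := h
    rw [pow_mul, hprim.pow_eq_one, one_pow, Nat.mul_div_cancel_left _ (Nat.pos_of_ne_zero hd)]
    simp only [one_pow, Finset.sum_const, Finset.card_range, nsmul_eq_mul, mul_one]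
    rw [mul_comm, Function.Periodic.qParam, ← Complex.exp_nat_mul]
    congr 2
    push_cast
    field_simp
  · have h1 : ζ ^ m ≠ 1 := fun h1 ↦ h (hprim.dvd_of_pow_eq_one _ h1)
    rw [geom_sum_eq h1, ← pow_mul, mul_comm m d, pow_mul, hprim.pow_eq_one, one_pow, sub_self,
      zero_div, mul_zero]

lemma hasSum_sum_comp_div {f : ℍ → ℂ} {a : ℕ → ℂ}
    (hf : ∀ z : ℍ, HasSum (fun m ↦ a m • 𝕢 1 (z : ℂ) ^ m) (f z)) {d e : ℕ} (hd : d ≠ 0)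
    (he : e ≠ 0) (z : ℍ) :
    HasSum (fun l ↦ (if e ∣ l then (d : ℂ) * a (d * (l / e)) else 0) * 𝕢 1 (z : ℂ) ^ l)
      (∑ b ∈ Finset.range d, f (ofComplex (((e : ℂ) * (z : ℂ) + b) / d))) := by
  have him (b : ℕ) : 0 < (((e : ℂ) * (z : ℂ) + b) / d).im := by
    have : (((e : ℂ) * (z : ℂ) + b) / d).im = e * z.im / d := by
      rw [Complex.div_natCast_im]
      simp
    rw [this]
    have := z.im_pos
    have : 0 < d := Nat.pos_of_ne_zero hd
    have : 0 < e := Nat.pos_of_ne_zero he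
    positivity
  have h1 : HasSum (fun m ↦ ∑ b ∈ Finset.range d, a m • 𝕢 1 (((e : ℂ) * (z : ℂ) + b) / d) ^ m)
      (∑ b ∈ Finset.range d, f (ofComplex (((e : ℂ) * (z : ℂ) + b) / d))) := by
    refine hasSum_sum fun b _ ↦ ?_
    have := hf (ofComplex (((e : ℂ) * (z : ℂ) + b) / d))
    rwa [ofComplex_apply_of_im_pos (him b)] at this ⊢
  simp_rw [smul_eq_mul, ← Finset.mul_sum, sum_qParam_pow hd] at h1
  have hdi : Function.Injective fun t : ℕ ↦ d * t := fun x y h ↦ Nat.eq_of_mul_eq_mul_left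
    (Nat.pos_of_ne_zero hd) h
  have hei : Function.Injective fun t : ℕ ↦ e * t := fun x y h ↦ Nat.eq_of_mul_eq_mul_left
    (Nat.pos_of_ne_zero he) h
  -- The surviving terms are m = dt on one side and l = et on the other; both series are reindexed
  -- by t.
  rw [← hdi.hasSum_iff] at h1
  · rw [← hei.hasSum_iff]
    · refine h1.congr_fun fun t ↦ ?_
      simp only [Function.comp_apply, dvd_mul_right, if_true,
        Nat.mul_div_cancel_left _ (Nat.pos_of_ne_zero hd),
        Nat.mul_div_cancel_left _ (Nat.pos_of_ne_zero he)]
      ring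
    · intro l hl
      rw [if_neg, zero_mul]
      rintro ⟨t, rfl⟩
      exact hl ⟨t, rfl⟩
  · intro l hl
    rw [if_neg, mul_zero]
    rintro ⟨t, rfl⟩
    exact hl ⟨t, rfl⟩

lemma hasSum_heckeCoeff (k : ℤ) {n : ℕ} (hn : n ≠ 0) {f : ℍ → ℂ} {a : ℕ → ℂ}
    (hf : ∀ z : ℍ, HasSum (fun m ↦ a m • 𝕢 1 (z : ℂ) ^ m) (f z)) (z : ℍ) :
    HasSum (fun l ↦ heckeCoeff k n a l • 𝕢 1 (z : ℂ) ^ l) (heckeOperator k n f z) := by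
  have h1 : HasSum (fun l ↦ (n : ℂ) ^ (k - 1) * ∑ d ∈ n.divisors, (d : ℂ) ^ (-k) *
      ((if n / d ∣ l then (d : ℂ) * a (d * (l / (n / d))) else 0) * 𝕢 1 (z : ℂ) ^ l))
      (heckeOperator k n f z) := by
    simp_rw [heckeOperator, ← Finset.mul_sum]
    refine HasSum.mul_left _ (hasSum_sum fun d hd ↦ HasSum.mul_left _ ?_)
    have hd := Nat.dvd_of_mem_divisors hd
    exact hasSum_sum_comp_div hf (ne_zero_of_dvd_ne_zero hn hd)
      (Nat.div_pos (Nat.le_of_dvd (Nat.pos_of_ne_zero hn) hd)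
        (Nat.pos_of_dvd_of_pos hd (Nat.pos_of_ne_zero hn))).ne' z
  refine h1.congr_fun fun l ↦ ?_
  -- The divisor in `heckeCoeff` is the complementary one, n / d.
  rw [heckeCoeff, ← Nat.sum_div_divisors, smul_eq_mul, Finset.sum_mul, Finset.mul_sum]
  refine Finset.sum_congr rfl fun d hd ↦ ?_
  have hdn := Nat.dvd_of_mem_divisors hd
  obtain ⟨e, rfl⟩ := hdn
  have hd0 : d ≠ 0 := left_ne_zero_of_mul hn
  have he0 : e ≠ 0 := right_ne_zero_of_mul hn
  have hd' : (d : ℂ) ≠ 0 := by exact_mod_cast hd0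
  rw [Nat.mul_div_cancel_left _ (Nat.pos_of_ne_zero hd0),
    Nat.mul_div_cancel _ (Nat.pos_of_ne_zero he0)]
  split_ifs with h
  · rw [Nat.cast_mul, mul_zpow, zpow_sub₀ hd', zpow_one, zpow_neg]
    field_simp
  · simp

/-- A divisor of pm that does not divide m is pd with d ∣ m; the condition p ∤ m/d says that pd ∤ m.
-/
lemma sum_divisors_prime_mul {M : Type*} [AddCommMonoid M] {p m : ℕ} (hp : p.Prime) (hm : m ≠ 0)
    (g : ℕ → M) :
    ∑ d ∈ (p * m).divisors, g d =
      ∑ d ∈ m.divisors, g d + ∑ d ∈ m.divisors with ¬ p ∣ m / d, g (p * d) := by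
  rw [← Finset.sum_filter_add_sum_filter_not _ (· ∣ m)]
  congr 1
  · refine Finset.sum_congr ?_ fun _ _ ↦ rfl
    ext d
    simp only [Finset.mem_filter, Nat.mem_divisors]
    exact ⟨fun h ↦ ⟨h.2, hm⟩, fun h ↦ ⟨⟨h.1.mul_left p, mul_ne_zero hp.ne_zero hm⟩, h.1⟩⟩
  · symm
    refine Finset.sum_bij (fun d _ ↦ p * d) ?_ ?_ ?_ fun _ _ ↦ rfl
    · intro d hd
      simp only [Finset.mem_filter, Nat.mem_divisors] at hd ⊢
      refine ⟨⟨mul_dvd_mul_left p hd.1.1, mul_ne_zero hp.ne_zero hm⟩, fun h ↦ hd.2 ?_⟩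
      exact (Nat.dvd_div_iff_mul_dvd hd.1.1).mpr (mul_comm p d ▸ h)
    · intro d _ d' _ h
      exact Nat.eq_of_mul_eq_mul_left hp.pos h
    · intro d hd
      simp only [Finset.mem_filter, Nat.mem_divisors] at hd
      obtain ⟨⟨hd1, -⟩, hd2⟩ := hd
      have hpd : p ∣ d := by
        by_contra h
        exact hd2 ((Nat.Coprime.dvd_of_dvd_mul_left
          ((Nat.Prime.coprime_iff_not_dvd hp).mpr h).symm) hd1)
      obtain ⟨t, rfl⟩ := hpd
      have ht : t ∣ m := Nat.dvd_of_mul_dvd_mul_left hp.pos hd1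
      refine ⟨t, ?_, rfl⟩
      simp only [Finset.mem_filter, Nat.mem_divisors]
      refine ⟨⟨ht, hm⟩, fun h ↦ hd2 ?_⟩
      rw [mul_comm]
      exact (Nat.dvd_div_iff_mul_dvd ht).mp h

lemma filter_divisors_dvd_div {p m : ℕ} (hp : p.Prime) (hm : m ≠ 0) :
    {d ∈ m.divisors | p ∣ m / d} = if p ∣ m then (m / p).divisors else ∅ := by
  ext d
  split_ifs with h
  · simp only [Finset.mem_filter, Nat.mem_divisors]
    have h0 : m / p ≠ 0 := (Nat.div_pos (Nat.le_of_dvd (Nat.pos_of_ne_zero hm) h) hp.pos).ne'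
    constructor
    · rintro ⟨⟨h1, -⟩, h2⟩
      refine ⟨(Nat.dvd_div_iff_mul_dvd h).mpr ?_, h0⟩
      rw [mul_comm]
      exact (Nat.dvd_div_iff_mul_dvd h1).mp h2
    · rintro ⟨h1, -⟩
      have h2 := (Nat.dvd_div_iff_mul_dvd h).mp h1
      have h3 : d ∣ m := (Dvd.intro_left p rfl).trans h2
      refine ⟨⟨h3, hm⟩, (Nat.dvd_div_iff_mul_dvd h3).mpr (mul_comm p d ▸ h2)⟩
  · simp only [Finset.mem_filter, Nat.mem_divisors, Finset.notMem_empty, iff_false, not_and]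
    exact fun h1 h2 ↦ h (h2.trans (Nat.div_dvd_of_dvd h1.1))

lemma heckeCoeff_prime (k : ℤ) {p : ℕ} (hp : p.Prime) (a : ℕ → ℂ) (j : ℕ) :
    heckeCoeff k p a j = a (p * j) + if p ∣ j then (p : ℂ) ^ (k - 1) * a (j / p) else 0 := by
  rw [heckeCoeff, hp.sum_divisors, add_comm]
  simp [Nat.div_self hp.pos]

lemma heckeCoeff_heckeCoeff_prime (k : ℤ) {p m : ℕ} (hp : p.Prime) (hm : m ≠ 0) (a : ℕ → ℂ)
    (l : ℕ) :
    heckeCoeff k m (heckeCoeff k p a) l = heckeCoeff k (p * m) a l +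
      if p ∣ m then (p : ℂ) ^ (k - 1) * heckeCoeff k (m / p) a l else 0 := by
  have e : (if p ∣ m then (p : ℂ) ^ (k - 1) * heckeCoeff k (m / p) a l else 0) =
      ∑ d ∈ m.divisors with p ∣ m / d, if d ∣ l then
        (p : ℂ) ^ (k - 1) * ((d : ℂ) ^ (k - 1) * a (m / p / d * (l / d))) else 0 := by
    rw [filter_divisors_dvd_div hp hm]
    split_ifs with h
    · rw [heckeCoeff, Finset.mul_sum]
      simp only [mul_ite, mul_zero]
    · simp
  rw [e, heckeCoeff, heckeCoeff, sum_divisors_prime_mul hp hm, add_assoc, Finset.sum_filter,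
    Finset.sum_filter, ← Finset.sum_add_distrib, ← Finset.sum_add_distrib]
  refine Finset.sum_congr rfl fun d hd ↦ ?_
  obtain ⟨hdm, -⟩ := Nat.mem_divisors.mp hd
  obtain ⟨u, rfl⟩ := hdm
  have hd0 : 0 < d := Nat.pos_of_ne_zero (left_ne_zero_of_mul hm)
  have hpd : ¬ d ∣ l → ¬ p * d ∣ l := fun h h' ↦ h ((Dvd.intro_left p rfl).trans h')
  by_cases hl : d ∣ l
  · obtain ⟨v, rfl⟩ := hl
    have e1 : p * (d * u) / d = p * u := by
      rw [show p * (d * u) = d * (p * u) by ring, Nat.mul_div_cancel_left _ hd0]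
    have e2 : p * (d * u) / (p * d) = u := by
      rw [← mul_assoc, Nat.mul_div_cancel_left _ (Nat.mul_pos hp.pos hd0)]
    have e3 : (p * d ∣ d * v) ↔ p ∣ v := by
      rw [mul_comm p d]; exact Nat.mul_dvd_mul_iff_left hd0
    simp only [dvd_mul_right, if_true, Nat.mul_div_cancel_left _ hd0, heckeCoeff_prime k hp, e1, e2,
      e3]
    rw [mul_add, mul_assoc p u v]
    congr 1
    -- Here u = m/d and v = l/d. The extra term of T_p comes from T_{m/p} if p ∣ u, from the new
    -- divisor pd of pm if only p ∣ v, and is absent otherwise.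
    by_cases hu : p ∣ u
    · obtain ⟨w, rfl⟩ := hu
      have e4 : d * (p * w) / p / d = w := by
        rw [show d * (p * w) = p * (d * w) by ring, Nat.mul_div_cancel_left _ hp.pos,
          Nat.mul_div_cancel_left _ hd0]
      have e5 : p * (w * v) / p = w * v := Nat.mul_div_cancel_left _ hp.pos
      simp only [dvd_mul_right, not_true, if_false, if_true, e4, e5, mul_assoc, zero_add]
      ring
    · by_cases hv : p ∣ v
      · obtain ⟨w, rfl⟩ := hv
        have e4 : d * (p * w) / (p * d) = w := by
          rw [show d * (p * w) = p * d * w by ring, Nat.mul_div_cancel_left _ (Nat.mul_pos hp.pos hd0)]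
        have e5 : u * (p * w) / p = u * w := by
          rw [show u * (p * w) = p * (u * w) by ring, Nat.mul_div_cancel_left _ hp.pos]
        have e6 : p ∣ u * (p * w) := Dvd.intro (u * w) (by ring)
        simp only [hu, not_false_eq_true, if_false, if_true, dvd_mul_right, e4, e5, e6, add_zero]
        push_cast
        rw [mul_zpow]
        ring
      · have e6 : ¬ p ∣ u * v := fun h ↦ (hp.dvd_mul.mp h).elim hu hv
        simp [hu, hv, e6]
  · simp [hl, hpd hl]

lemma heckeOperator_heckeOperator_prime {k : ℤ} (f : CuspForm 𝒮ℒ k) {p m : ℕ} (hp : p.Prime)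
    (hm : m ≠ 0) (z : ℍ) :
    heckeOperator k m (heckeOperator k p f) z = heckeOperator k (p * m) f z +
      if p ∣ m then (p : ℂ) ^ (k - 1) * heckeOperator k (m / p) f z else 0 := by
  have hf (z : ℍ) := ModularForm.hasSum_qExpansion f one_pos (by simp) z
  have h1 := hasSum_heckeCoeff k hm (hasSum_heckeCoeff k hp.ne_zero hf) z
  have h2 := hasSum_heckeCoeff k (mul_ne_zero hp.ne_zero hm) hf z
  refine h1.unique ?_
  simp_rw [heckeCoeff_heckeCoeff_prime k hp hm, add_smul]
  refine h2.add ?_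
  split_ifs with h
  · have h0 : m / p ≠ 0 := (Nat.div_pos (Nat.le_of_dvd (Nat.pos_of_ne_zero hm) h) hp.pos).ne'
    simpa only [smul_eq_mul, mul_assoc] using (hasSum_heckeCoeff k h0 hf z).mul_left _
  · simp

end LevelOne

end

noncomputable section

namespace LevelOne

open MeasureTheory Complex
open scoped ModularForm Real

/-! ### Central values -/

section CentralValue

variable {k : ℤ}

lemma isHeckeLFunction_L (hk : 0 < k) (f : CuspForm 𝒮ℒ k) :
    IsHeckeLFunction f (ModularForm.L hk f) := by
  refine ⟨CuspForm.differentiable_L hk f, fun s hs ↦ ?_⟩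
  have h := CuspForm.hasSum_L hk f hs
  have h0 : (qExpansion 1 f).coeff 0 = 0 :=
    CuspFormClass.qExpansion_coeff_zero f one_pos (by simp)
  simp only [Subgroup.strictWidthInfty_SL2Z, ofReal_one, one_cpow, one_mul] at h
  refine h.congr_fun fun n ↦ ?_
  rcases eq_or_ne n 0 with rfl | hn
  · simp [h0]
  · simp [LSeries.term_of_ne_zero hn]

/-- The completed function is this Mellin transform, and the Gamma factor is nonzero at k/2 > 0. -/
lemma heckeL_ne_zero_iff (hk : 0 < k) (f : CuspForm 𝒮ℒ k) :
    heckeL f ((k : ℂ) / 2) ≠ 0 ↔ mellin (fun t : ℝ ↦ f (ofComplex (I * t))) ((k : ℂ) / 2) ≠ 0 := by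
  rw [(heckeL_spec f).unique (isHeckeLFunction_L hk f), ModularForm.L, CuspForm.Λ_eq_mellin]
  have h : Gammaℂ ((k : ℂ) / 2) ≠ 0 := by
    have hs : 0 < ((k : ℂ) / 2).re := by
      have : ((k : ℂ) / 2).re = (k : ℝ) / 2 := by simp
      rw [this]
      have : (0 : ℝ) < k := by exact_mod_cast hk
      positivity
    rw [Gammaℂ]
    refine mul_ne_zero (mul_ne_zero two_ne_zero ?_) (Gamma_ne_zero_of_re_pos hs)
    exact (cpow_ne_zero_iff_of_exponent_ne_zero (fun h ↦ by simp [neg_eq_zero.mp h] at hs)).mpr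
      (by simp [Real.pi_ne_zero])
  simp [h]

lemma mellinConvergent_cuspForm (hk : 0 < k) (f : CuspForm 𝒮ℒ k) (s : ℂ) :
    MellinConvergent (fun t : ℝ ↦ f (ofComplex (I * t))) s :=
  ((CuspForm.isStrongFEPair hk f).hasMellin s).1

lemma four_dvd_of_mellin_ne_zero (hk : 0 < k) (f : CuspForm 𝒮ℒ k)
    (h : mellin (fun t : ℝ ↦ f (ofComplex (I * t))) ((k : ℂ) / 2) ≠ 0) : 4 ∣ k := by
  set P := ModularForm.weakFEPair hk f with hP
  have h1 := P.functional_equation ((k : ℂ) / 2)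
  have hs := CuspForm.isStrongFEPair hk f
  -- The dual function is f∣S restricted to the imaginary axis, so invariance under S makes the pair
  -- self-dual with sign i^k.
  have hg : P.g = P.f := by
    have h3 := SlashInvariantFormClass.slash_action_eq f
      ((ModularGroup.S : SL(2, ℤ)) : GL (Fin 2) ℝ) (MonoidHom.mem_range.mpr ⟨ModularGroup.S, rfl⟩)
    funext t
    exact congr_fun h3 (ofComplex (I * t))
  have e : (P.k : ℂ) - k / 2 = k / 2 := by
    have : (P.k : ℂ) = k := by simp [hP]
    rw [this]; ring
  rw [e, hs.symm_Λ_eq, hs.Λ_eq, ← hP, hg] at h1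
  have h2 : I ^ k = 1 := by
    have h3 : mellin P.f ((k : ℂ) / 2) ≠ 0 := h
    have h4 : P.ε = I ^ k := rfl
    rw [h4, smul_eq_mul] at h1
    exact mul_right_cancel₀ h3 (h1.symm.trans (one_mul _).symm)
  exact_mod_cast (isPrimitiveRoot_I.zpow_eq_one_iff_dvd k).mp h2

end CentralValue

/-! ### Positivity of Δ E₄^j on the imaginary axis -/

section Positivity

/-- The point `i t` of the upper half-plane. -/
def imagAxis (t : ℝ) (ht : 0 < t) : ℍ := ⟨I * t, by simpa using ht⟩

lemma qParam_imagAxis {t : ℝ} (ht : 0 < t) (h : ℝ) :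
    Function.Periodic.qParam h (imagAxis t ht) = (Real.exp (-(2 * π * t / h)) : ℂ) := by
  rw [Function.Periodic.qParam, ofReal_exp]
  congr 1
  simp only [imagAxis]
  push_cast
  linear_combination (2 * π * t / h : ℂ) * I_mul_I

/-- At it the parameter q is positive, and the coefficients 1 and 240 σ₃(m) are too, with 240 = -8 /
B₄. -/
lemma E₄_imagAxis {t : ℝ} (ht : 0 < t) :
    ∃ r : ℝ, 0 < r ∧ ModularForm.E₄ (imagAxis t ht) = r := by
  have h := ModularForm.hasSum_qExpansion ModularForm.E₄ one_pos (by simp) (imagAxis t ht)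
  set x := Real.exp (-(2 * π * t / 1)) with hx
  set c : ℕ → ℝ := fun m ↦ if m = 0 then 1 else 240 * (ArithmeticFunction.sigma 3 m : ℝ) with hc
  have hcoeff (m : ℕ) : (qExpansion 1 ModularForm.E₄).coeff m = c m := by
    have := EisensteinSeries.E_qExpansion_coeff (k := 4) (by norm_num) ⟨2, rfl⟩ m
    rw [ModularForm.E₄, this, hc]
    split_ifs with h0
    · simp [h0]
    · simp only [h0, if_false, show bernoulli 4 = -1 / 30 by decide +kernel]
      push_cast
      norm_num
  have hre : HasSum (fun m ↦ c m * x ^ m) (ModularForm.E₄ (imagAxis t ht)).re := by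
    refine (hasSum_re h).congr_fun fun m ↦ ?_
    rw [hcoeff, qParam_imagAxis, ← hx, ← ofReal_pow, ← ofReal_mul, ofReal_re]
  have him : (ModularForm.E₄ (imagAxis t ht)).im = 0 := by
    refine (hasSum_im h).unique (hasSum_zero.congr_fun fun m ↦ ?_)
    rw [hcoeff, qParam_imagAxis, ← hx, ← ofReal_pow, ← ofReal_mul, ofReal_im]
  refine ⟨_, ?_, Complex.ext rfl him⟩
  have hx0 : 0 < x := Real.exp_pos _
  have hnn (m : ℕ) : 0 ≤ c m * x ^ m := by
    simp only [hc]
    split_ifs <;> positivity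
  have := le_hasSum hre 0 fun m _ ↦ hnn m
  simp only [hc, if_true, pow_zero, mul_one] at this
  linarith

/-- Being the 24th power of a real number, Δ(it) is nonnegative, and Δ has no zero. The eta product
is real because ℝ is closed in ℂ and contains the partial products. -/
lemma discriminant_imagAxis {t : ℝ} (ht : 0 < t) :
    ∃ r : ℝ, 0 < r ∧ ModularForm.discriminant (imagAxis t ht) = r := by
  set z := imagAxis t ht with hz
  obtain ⟨y, hy⟩ : ∃ y : ℝ, (y : ℂ) = ∏' n, (1 - ModularForm.eta_q n z) := by
    have hq : ‖Function.Periodic.qParam 1 (z : ℂ)‖ < 1 :=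
      Function.Periodic.norm_qParam_lt_one one_pos z.im_pos
    have hprod := (ModularForm.multipliable_one_sub_pow hq).hasProd
    refine isometry_ofReal.isClosedEmbedding.isClosed_range.mem_of_tendsto hprod (.of_forall fun s ↦ ?_)
    refine ⟨∏ n ∈ s, (1 - Real.exp (-(2 * π * t / 1)) ^ (n + 1)), ?_⟩
    rw [hz, qParam_imagAxis]
    push_cast
    rfl
  have h : ModularForm.discriminant z = ((Real.exp (-(2 * π * t / 24)) * y) ^ 24 : ℝ) := by
    rw [ModularForm.discriminant, ModularForm.eta, ← hy, hz, qParam_imagAxis]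
    push_cast
    rfl
  have h0 := ModularForm.discriminant_ne_zero z
  rw [h, ofReal_ne_zero] at h0
  exact ⟨_, lt_of_le_of_ne (Even.pow_nonneg ⟨12, rfl⟩ _) h0.symm, h⟩

lemma exists_cuspForm_mellin_ne_zero {k : ℤ} (hk : 12 ≤ k) (h4 : 4 ∣ k) :
    ∃ f : CuspForm 𝒮ℒ k, mellin (fun t : ℝ ↦ f (ofComplex (I * t))) ((k : ℂ) / 2) ≠ 0 := by
  obtain ⟨j, rfl⟩ : ∃ j : ℕ, k = 12 + j * 4 := by
    obtain ⟨m, rfl⟩ := h4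
    exact ⟨(m - 3).toNat, by omega⟩
  set f : CuspForm 𝒮ℒ (12 + j * 4) :=
    CuspForm.discriminant.mulModularForm (ModularForm.E₄.pow j)
  have hf (t : ℝ) (ht : 0 < t) : ∃ r : ℝ, 0 < r ∧ f (ofComplex (I * t)) = r := by
    obtain ⟨r, hr, hr'⟩ := E₄_imagAxis ht
    obtain ⟨s, hs, hs'⟩ := discriminant_imagAxis ht
    refine ⟨s * r ^ j, by positivity, ?_⟩
    have e : ofComplex (I * t) = imagAxis t ht := ofComplex_apply_of_im_pos _
    rw [e, CuspForm.coe_mulModularForm]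
    simp [hr', hs']
  refine ⟨f, fun h0 ↦ ?_⟩
  set s : ℂ := ((12 + j * 4 : ℤ) : ℂ) / 2 with hs
  have hint : IntegrableOn (fun t : ℝ ↦ (t : ℂ) ^ (s - 1) • f (ofComplex (I * t))) (Set.Ioi 0) :=
    mellinConvergent_cuspForm (by omega) f s
  have hpos (t : ℝ) (ht : 0 < t) : 0 < ((t : ℂ) ^ (s - 1) • f (ofComplex (I * t))).re := by
    obtain ⟨r, hr, hr'⟩ := hf t ht
    -- The exponent k/2 - 1 is a natural number, so the complex power is an ordinary real power.
    have : s - 1 = ((5 + j * 2 : ℕ) : ℂ) := by rw [hs]; push_cast; ring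
    rw [hr', this, cpow_natCast, smul_eq_mul, ← ofReal_pow, ← ofReal_mul, ofReal_re]
    positivity
  have h1 : ∫ t in Set.Ioi (0 : ℝ), ((t : ℂ) ^ (s - 1) • f (ofComplex (I * t))).re = 0 := by
    have := integral_re hint
    simp only [RCLike.re_eq_complex_re] at this
    rw [this]
    have h0' : ∫ t in Set.Ioi (0 : ℝ), (t : ℂ) ^ (s - 1) • f (ofComplex (I * t)) = 0 := h0
    rw [h0', zero_re]
  have h2 : 0 < ∫ t in Set.Ioi (0 : ℝ), ((t : ℂ) ^ (s - 1) • f (ofComplex (I * t))).re := by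
    rw [setIntegral_pos_iff_support_of_nonneg_ae]
    · refine lt_of_lt_of_le ?_ (measure_mono (s := Set.Ioi (0 : ℝ)) fun t ht ↦ ⟨(hpos t ht).ne', ht⟩)
      simp
    · exact (ae_restrict_iff' measurableSet_Ioi).mpr (.of_forall fun t ht ↦ (hpos t ht).le)
    · exact hint.re
  exact h2.ne' h1

end Positivity

end LevelOne

end

noncomputable section

namespace LevelOne

/-! ### Eigenforms -/

section Eigenforms

variable {k : ℤ}

instance finiteDimensional_cuspForm (k : ℤ) : FiniteDimensional ℂ (CuspForm 𝒮ℒ k) :=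
  (CuspForm.discriminantEquiv (k := k)).symm.finiteDimensional

/-- T_n is symmetric for the Petersson product; the inner product structure stays local to this
proof. -/
lemma isFinitelySemisimple_heckeEnd (k : ℤ) (n : ℕ) [NeZero n] :
    (heckeEnd k n).IsFinitelySemisimple := by
  let _ : NormedAddCommGroup (CuspForm 𝒮ℒ k) := (peterssonCore k).toNormedAddCommGroup
  let _ : InnerProductSpace ℂ (CuspForm 𝒮ℒ k) := InnerProductSpace.ofCore (peterssonCore k).toCore
  have h : (heckeEnd k n).IsSymmetric := fun f g ↦ peterssonInner_hecke_symm f g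
  exact h.isFinitelySemisimple

instance neZero_prime (p : Nat.Primes) : NeZero (p : ℕ) := ⟨p.2.ne_zero⟩

lemma commute_heckeEnd {p q : Nat.Primes} (hpq : p ≠ q) :
    Commute (heckeEnd k (p : ℕ)) (heckeEnd k (q : ℕ)) := by
  have hne : (p : ℕ) ≠ q := fun h ↦ hpq (Subtype.ext h)
  have h1 : ¬ (p : ℕ) ∣ q := fun h ↦ hne ((Nat.prime_dvd_prime_iff_eq p.2 q.2).mp h)
  have h2 : ¬ (q : ℕ) ∣ p := fun h ↦ hne ((Nat.prime_dvd_prime_iff_eq q.2 p.2).mp h).symm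
  refine LinearMap.ext fun f ↦ CuspForm.ext fun z ↦ ?_
  change heckeOperator k p (heckeOperator k q f) z = heckeOperator k q (heckeOperator k p f) z
  rw [heckeOperator_heckeOperator_prime f q.2 p.2.ne_zero,
    heckeOperator_heckeOperator_prime f p.2 q.2.ne_zero, if_neg h1, if_neg h2, mul_comm]

/-- Commuting operators on a finite-dimensional complex space have spanning joint generalized
eigenspaces; semisimplicity makes these true eigenspaces. -/
lemma iSup_iInf_eigenspace_heckeEnd (k : ℤ) :
    ⨆ χ : Nat.Primes → ℂ, ⨅ p : Nat.Primes, (heckeEnd k (p : ℕ)).eigenspace (χ p) = ⊤ := by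
  have h := Module.End.iSup_iInf_maxGenEigenspace_eq_top_of_iSup_maxGenEigenspace_eq_top_of_commute
    (fun p : Nat.Primes ↦ heckeEnd k (p : ℕ)) (fun p q hpq ↦ commute_heckeEnd hpq)
    (fun p ↦ Module.End.iSup_maxGenEigenspace_eq_top _)
  simpa only [(isFinitelySemisimple_heckeEnd k _).maxGenEigenspace_eq_eigenspace] using h

lemma heckeOperator_one (f : ℍ → ℂ) (z : ℍ) : heckeOperator k 1 f z = f z := by
  simp [heckeOperator]

/-- Strong induction on T_{pm} = T_m T_p - p^(k-1) T_{m/p}. -/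
lemma exists_eigenvalue_of_primes (f : CuspForm 𝒮ℒ k) (χ : Nat.Primes → ℂ)
    (hf : ∀ p : Nat.Primes, heckeOperator k p f = χ p • ⇑f) (n : ℕ) (hn : n ≠ 0) :
    ∃ c : ℂ, ∀ z : ℍ, heckeOperator k n f z = c * f z := by
  induction n using Nat.strong_induction_on with | _ n ih =>
  rcases eq_or_ne n 1 with rfl | h1
  · exact ⟨1, fun z ↦ by rw [heckeOperator_one, one_mul]⟩
  obtain ⟨p, hp, m, rfl⟩ := Nat.exists_prime_and_dvd h1
  have hm : m ≠ 0 := right_ne_zero_of_mul hn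
  have hlt : m < p * m := lt_mul_left (Nat.pos_of_ne_zero hm) hp.one_lt
  obtain ⟨c, hc⟩ := ih m hlt hm
  have key (z : ℍ) := heckeOperator_heckeOperator_prime f hp hm z
  have hp' := hf ⟨p, hp⟩
  simp only at hp'
  simp only [hp', heckeOperator_smul, Pi.smul_apply, smul_eq_mul, hc] at key
  by_cases hpm : p ∣ m
  · have h0 : m / p ≠ 0 := (Nat.div_pos (Nat.le_of_dvd (Nat.pos_of_ne_zero hm) hpm) hp.pos).ne'
    obtain ⟨c', hc'⟩ := ih (m / p) ((Nat.div_le_self m p).trans_lt hlt) h0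
    refine ⟨χ ⟨p, hp⟩ * c - (p : ℂ) ^ (k - 1) * c', fun z ↦ ?_⟩
    have := key z
    rw [if_pos hpm, hc'] at this
    linear_combination -this
  · refine ⟨χ ⟨p, hp⟩ * c, fun z ↦ ?_⟩
    have := key z
    rw [if_neg hpm] at this
    linear_combination -this

/-- The central value of the completed `L`-function, as a linear functional. -/
def centralValue (hk : 0 < k) : CuspForm 𝒮ℒ k →ₗ[ℂ] ℂ where
  toFun f := mellin (fun t : ℝ ↦ f (ofComplex (Complex.I * t))) ((k : ℂ) / 2)
  map_add' f g := (hasMellin_add (mellinConvergent_cuspForm hk f _)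
    (mellinConvergent_cuspForm hk g _)).2
  map_smul' c _ := mellin_const_smul _ _ c

/-- A linear functional that kills every eigenform kills their span, which is the whole space. -/
lemma exists_isHeckeEigenform_centralValue_ne_zero (hk : 0 < k)
    (h : ∃ f : CuspForm 𝒮ℒ k, centralValue hk f ≠ 0) :
    ∃ f : CuspForm 𝒮ℒ k, IsHeckeEigenform f ∧ centralValue hk f ≠ 0 := by
  by_contra! hcon
  obtain ⟨f, hf⟩ := h
  have hle : ⨆ χ : Nat.Primes → ℂ, ⨅ p : Nat.Primes, (heckeEnd k (p : ℕ)).eigenspace (χ p) ≤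
      LinearMap.ker (centralValue hk) := by
    refine iSup_le fun χ g hg ↦ ?_
    rw [LinearMap.mem_ker]
    rcases eq_or_ne g 0 with rfl | hg0
    · exact map_zero _
    refine hcon g ⟨hg0, fun n hn ↦ exists_eigenvalue_of_primes g χ (fun p ↦ ?_) n (by omega)⟩
    have := Module.End.mem_eigenspace_iff.mp ((Submodule.mem_iInf _).mp hg p)
    exact congrArg DFunLike.coe this
  rw [iSup_iInf_eigenspace_heckeEnd] at hle
  exact hf (LinearMap.mem_ker.mp (hle Submodule.mem_top))

end Eigenforms

end LevelOne

end

theorem mainTheorem1 (k : ℤ) :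
    (∃ f : CuspForm 𝒮ℒ k, LevelOne.IsHeckeEigenform f ∧ LevelOne.heckeL f ((k : ℂ) / 2) ≠ 0) ↔
      12 ≤ k ∧ 4 ∣ k := by
  constructor
  · rintro ⟨f, hf, hL⟩
    have hk : 12 ≤ k := by
      by_contra! hk
      have := rank_zero_iff.mp (CuspForm.rank_eq_zero_of_weight_lt_twelve hk)
      exact hf.1 (Subsingleton.elim _ _)
    have hk0 : 0 < k := by omega
    exact ⟨hk, LevelOne.four_dvd_of_mellin_ne_zero hk0 f
      ((LevelOne.heckeL_ne_zero_iff hk0 f).mp hL)⟩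
  · rintro ⟨hk, h4⟩
    have hk0 : 0 < k := by omega
    obtain ⟨f, hf, hf'⟩ := LevelOne.exists_isHeckeEigenform_centralValue_ne_zero hk0
      (LevelOne.exists_cuspForm_mellin_ne_zero hk h4)
    exact ⟨f, hf, (LevelOne.heckeL_ne_zero_iff hk0 f).mpr hf'⟩
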